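/- Let $\mathcal C=(S,\Delta,r)$ be a semimatroid on a finite set $S$: $\Delta$ is a non-void simplicial complex on $S$ (a family of subsets closed under taking subsets, so $\emptyset\in\Delta$; elements of $S$ need not be vertices) and $r:\Delta\to\mathbb N$ satisfies, for all $\sigma,\tau\in\Delta$: (1) $0\le r(\sigma)\le|\sigma|$; (2) $\sigma\subseteq\tau$ implies $r(\sigma)\le r(\tau)$; (3) if $\sigma\cup\tau\in\Delta$ then $r(\sigma)+r(\tau)\ge r(\sigma\cup\tau)+r(\sigma\cap\tau)$; (4) if $r(\sigma)=r(\sigma\cap\tau)$ then $\sigma\cup\tau\in\Delta$; (5) if $r(\sigma)<r(\tau)$ then $\sigma\cup\{y\}\in\Delta$ for some $y\in\tau\setminus\sigma$. Fix a linear order on $S$. A face $\sigma$ is dependent if $r(\sigma)<|\sigma|$ and independent otherwise; a circuit is a minimal dependent face and a basis is a maximal independent face. A broken circuit is a set $\sigma\setminus\{\min\sigma\}$ with $\sigma$ a circuit. The broken circuit complex $BC(\mathcal C)$ is the complex of all faces of $\Delta$ that contain no broken circuit (no-broken circuits); it is void if there is a one-element circuit. A no-broken circuit $\sigma$ is critical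 if for every $x\in\sigma$ there is $y\in S\setminus\sigma$ with $y<x$ such that $(\sigma\setminus\{x\})\cup\{y\}$ is again a no-broken circuit. $CBC(\mathcal C)$ is the set of critical no-broken circuits that are bases. An elementary simplicial collapse removes from a complex a face $\sigma$ together with a face $\tau\supset\sigma$, $|\tau|=|\sigma|+1$, which is the only face properly containing $\sigma$; here $\sigma=\emptyset$ is allowed (this matters only if the final complex is void). Let $R$ be a field or, more generally, an integral domain (such as $\mathbb Z$). For complexes $L\subseteq K$ on $S$ let $\widetilde H_{d}(K,L;R)$ be relative reduced simplicial homology (the empty face spans the chains of degree $-1$, and $L$ may be void). For a monotone $f:\Delta\to\mathbb N$ put $\Delta_{\le j}=\{\sigma\in\Delta: f(\sigma)\le j\}$, $\Delta_{<j}=\{\sigma\in\Delta:f(\sigma)<j\}$, and $$P(f;q,x)=\sum_{i,j\ge0}\operatorname{rank}_R\widetilde H_{i-1}(\Delta_{\le j},\Delta_{<j};R)\,x^jq^i,\qquad P(\Delta;q)=\sum_{i\ge0}\operatorname{rank}_R\widetilde H_{i-1}(\Delta;R)\,q^i .$$ Theorem. $\Delta$ collapses onto $BC(\mathcal C)$ by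 a finite sequence of elementary simplicial collapses. Moreover $$P(r;q,x)=\sum_{\sigma\in BC(\mathcal C)}(qx)^{|\sigma|}\qquad\text{and}\qquad P(\Delta;q)=\sum_{\sigma\in CBC(\mathcal C)}q^{|\sigma|}.$$ -/

import Mathlib

/-!
Throughout, an abstract simplicial complex on `S` is a lower set of `Finset S`: a family of finite
sets closed under passing to subsets.  It may be void (no faces at all), it contains the empty face
as soon as it is not void, and elements of `S` need not be vertices.
-/

/-- A semimatroid `(S, Δ, r)`.  The rank function is written as a total function, but only its
values on faces are constrained, and only those are ever used. -/
structure Semimatroid (S : Type*) [DecidableEq S] where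
  complex : LowerSet (Finset S)
  rank : Finset S → ℕ
  nonvoid : (complex : Set (Finset S)).Nonempty
  rank_le_card : ∀ σ ∈ complex, rank σ ≤ σ.card
  rank_mono : ∀ σ ∈ complex, ∀ τ ∈ complex, σ ⊆ τ → rank σ ≤ rank τ
  rank_submodular : ∀ σ ∈ complex, ∀ τ ∈ complex, σ ∪ τ ∈ complex →
    rank (σ ∪ τ) + rank (σ ∩ τ) ≤ rank σ + rank τ
  union_mem : ∀ σ ∈ complex, ∀ τ ∈ complex, rank σ = rank (σ ∩ τ) → σ ∪ τ ∈ complex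
  exists_insert_mem : ∀ σ ∈ complex, ∀ τ ∈ complex, rank σ < rank τ →
    ∃ y ∈ τ \ σ, insert y σ ∈ complex

namespace Semimatroid

section
variable {S : Type*} [DecidableEq S] (C : Semimatroid S)

def IsDependent (σ : Finset S) : Prop := σ ∈ C.complex ∧ C.rank σ < σ.card

def IsIndependent (σ : Finset S) : Prop := σ ∈ C.complex ∧ ¬ C.rank σ < σ.card

/-- A circuit is an inclusion-minimal dependent face. -/
def IsCircuit (σ : Finset S) : Prop := Minimal C.IsDependent σ

/-- A basis is an inclusion-maximal independent face. -/
def IsBasis (σ : Finset S) : Prop := Maximal C.IsIndependent σ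

end

section
variable {S : Type*} [LinearOrder S] (C : Semimatroid S)

/-- A broken circuit is a circuit with its smallest element removed. -/
def IsBrokenCircuit (β : Finset S) : Prop :=
  ∃ σ, C.IsCircuit σ ∧ ∃ h : σ.Nonempty, β = σ.erase (σ.min' h)

/-- The broken circuit complex: the faces that contain no broken circuit.  It is void if there is
a loop, because then the empty set is a broken circuit. -/
def brokenCircuitComplex : LowerSet (Finset S) where
  carrier := {τ | τ ∈ C.complex ∧ ∀ β, C.IsBrokenCircuit β → ¬ β ⊆ τ}
  lower' := fun _ _ hba ha =>
    ⟨C.complex.lower hba ha.1, fun β hβ h => ha.2 β hβ (h.trans hba)⟩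

/-- A no-broken circuit `σ` is critical if each `x ∈ σ` can be exchanged for some smaller element
`y ∉ σ` in such a way that the result is still a no-broken circuit. -/
def IsCritical (σ : Finset S) : Prop :=
  σ ∈ C.brokenCircuitComplex ∧
    ∀ x ∈ σ, ∃ y, y < x ∧ y ∉ σ ∧ insert y (σ.erase x) ∈ C.brokenCircuitComplex

open scoped Classical in
/-- The faces of the broken circuit complex, as a finite set. -/
noncomputable def nbcFinset [Fintype S] : Finset (Finset S) :=
  Finset.univ.filter (fun σ => σ ∈ C.brokenCircuitComplex)

open scoped Classical in
/-- The critical no-broken circuits that are bases. -/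
noncomputable def criticalBases [Fintype S] : Finset (Finset S) :=
  Finset.univ.filter (fun σ => C.IsCritical σ ∧ C.IsBasis σ)

end

end Semimatroid

namespace SimplicialPair

/-- `K` collapses to `L` by one elementary simplicial collapse: `L` is obtained from `K` by
removing a free face `σ` and the unique face `τ` of `K` properly containing it, where
`dim τ = dim σ + 1`.  The empty face is allowed as `σ`, which happens only when a complex with a
single vertex and no other nonempty face is replaced by the void complex; it cannot happen in a
sequence of collapses that ends in a non-void complex. -/
def ElementaryCollapse {S : Type*} (K L : LowerSet (Finset S)) : Prop :=
  ∃ σ τ : Finset S, σ ∈ K ∧ τ ∈ K ∧ σ ⊂ τ ∧ τ.card = σ.card + 1 ∧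
    (∀ ρ ∈ K, σ ⊂ ρ → ρ = τ) ∧ (L : Set (Finset S)) = (K : Set (Finset S)) \ {σ, τ}

/-- `K` collapses onto `L` by a finite sequence of elementary simplicial collapses. -/
def CollapsesOnto {S : Type*} (K L : LowerSet (Finset S)) : Prop :=
  Relation.ReflTransGen ElementaryCollapse K L

/-- The subquotient `Z / (B ∩ Z)` of a module, which is `Z / B` when `B ⊆ Z`. -/
abbrev Subquotient {R M : Type*} [Ring R] [AddCommGroup M] [Module R M] (Z B : Submodule R M) :
    Type _ :=
  Z ⧸ B.submoduleOf Z

section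
variable (R : Type*) [CommRing R] {S : Type*}

/-- The chains of `K` spanned by the faces with exactly `n` elements, that is, of dimension
`n - 1`.  The empty face spans the chains of dimension `-1`. -/
noncomputable def chains (K : Set (Finset S)) (n : ℕ) : Submodule R (Finset S →₀ R) :=
  Finsupp.supported R R {σ | σ ∈ K ∧ σ.card = n}

variable [LinearOrder S]

/-- The augmented simplicial boundary,
`∂ [x₀ < ⋯ < xₘ] = ∑ i, (-1) ^ i • [x₀, ⋯, x̂ᵢ, ⋯, xₘ]`; it sends a vertex to the empty face and
the empty face to `0`. -/
noncomputable def boundary : (Finset S →₀ R) →ₗ[R] (Finset S →₀ R) :=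
  Finsupp.linearCombination R fun σ : Finset S =>
    ∑ x ∈ σ, Finsupp.single (σ.erase x) ((-1 : R) ^ (σ.filter (· < x)).card)

theorem boundary_boundary :
    boundary R (S := S) ∘ₗ boundary R = 0 := by
  ext1 σ
  ext1
  simp only [boundary, LinearMap.coe_comp, Function.comp_apply, Finsupp.lsingle_apply,
    Finsupp.linearCombination_single, one_smul, map_sum, LinearMap.zero_comp, LinearMap.zero_apply,
    Finset.smul_sum, Finsupp.smul_single, smul_eq_mul]
  rw [Finset.sum_sigma']
  refine Finset.sum_involution (fun p _ => ⟨p.2, p.1⟩) ?_ ?_ ?_ ?_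
  · rintro ⟨x, y⟩ h
    simp only [Finset.mem_sigma, Finset.mem_erase] at h
    obtain ⟨hx, hyx, hy⟩ := h
    have hc : (σ.erase x).erase y = (σ.erase y).erase x := Finset.erase_right_comm
    have main : ∀ x y : S, x ∈ σ → y ∈ σ → x < y →
        (-1 : R) ^ (σ.filter (· < x)).card * (-1) ^ ((σ.erase x).filter (· < y)).card +
        (-1 : R) ^ (σ.filter (· < y)).card * (-1) ^ ((σ.erase y).filter (· < x)).card = 0 := by
      intro x y hx hy hxy
      have h1 : (σ.erase y).filter (· < x) = σ.filter (· < x) := by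
        ext z; simp only [Finset.mem_filter, Finset.mem_erase]
        constructor
        · rintro ⟨⟨_, h⟩, h'⟩; exact ⟨h, h'⟩
        · rintro ⟨h, h'⟩; exact ⟨⟨(h'.trans hxy).ne, h⟩, h'⟩
      have h2 : (σ.erase x).filter (· < y) = (σ.filter (· < y)).erase x := by
        rw [Finset.filter_erase]
      have h3 : ((σ.filter (· < y)).erase x).card + 1 = (σ.filter (· < y)).card :=
        Finset.card_erase_add_one (by simp [hx, hxy])
      rw [h1, h2, ← h3, pow_succ]
      ring
    dsimp only
    rw [hc, ← Finsupp.single_add]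
    rw [show _ + _ = (0 : R) from ?_, Finsupp.single_zero]
    rcases lt_or_gt_of_ne hyx with h | h
    · rw [add_comm]; exact main y x hy hx h
    · exact main x y hx hy h
  · rintro ⟨x, y⟩ h _ heq
    simp only [Finset.mem_sigma, Finset.mem_erase] at h
    simp only [Sigma.mk.injEq] at heq
    exact h.2.1 heq.1
  · rintro ⟨x, y⟩ h
    simp only [Finset.mem_sigma, Finset.mem_erase] at h ⊢
    exact ⟨h.2.2, h.2.1.symm, h.1⟩
  · rintro ⟨x, y⟩ h
    rfl

/-- Relative cycles of the pair `(K, L)`: chains of `K` with boundary in `L`. -/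
noncomputable def relCycles (K L : Set (Finset S)) (n : ℕ) : Submodule R (Finset S →₀ R) :=
  chains R K n ⊓ (Finsupp.supported R R L).comap (boundary R)

/-- Relative boundaries of the pair `(K, L)`: boundaries of chains of `K`, up to chains of `L`. -/
noncomputable def relBoundaries (K L : Set (Finset S)) (n : ℕ) : Submodule R (Finset S →₀ R) :=
  (chains R K (n + 1)).map (boundary R) ⊔ chains R L n

/-- The reduced relative homology `H̃_{n-1}(K, L; R)` of complexes `L ⊆ K`.  The index `n` is the
number of elements of the faces, so it is one more than the dimension. -/
abbrev RelHomology (K L : Set (Finset S)) (n : ℕ) : Type _ :=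
  Subquotient (relCycles R K L n) (relBoundaries R K L n)

/-- The reduced relative Betti number `rank H̃_{n-1}(K, L; R)`. -/
noncomputable def relBetti (K L : Set (Finset S)) (n : ℕ) : ℕ :=
  Module.finrank R (RelHomology R K L n)

/-- The subcomplex `Δ_{≤ j}` of a function `f` on the faces of `Δ`. -/
def sublevel (Δ : LowerSet (Finset S)) (f : Finset S → ℕ) (j : ℕ) : Set (Finset S) :=
  {σ | σ ∈ Δ ∧ f σ ≤ j}

/-- The subcomplex `Δ_{< j}` of a function `f` on the faces of `Δ`. -/
def strictSublevel (Δ : LowerSet (Finset S)) (f : Finset S → ℕ) (j : ℕ) : Set (Finset S) :=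
  {σ | σ ∈ Δ ∧ f σ < j}

open scoped Classical in
/-- The Poincaré polynomial `P(f; q, x) = ∑ rank H̃_{i-1}(Δ_{≤ j}, Δ_{< j}) x ^ j q ^ i` of a
monotone function `f` on the faces of `Δ`, with `q = X 0` and `x = X 1`.  The terms left out of the
finite sum are zero, see `coeff_poincare`. -/
noncomputable def poincare [Fintype S] (Δ : LowerSet (Finset S)) (f : Finset S → ℕ) :
    MvPolynomial (Fin 2) ℤ :=
  ∑ i ∈ Finset.range (Fintype.card S + 1),
    ∑ j ∈ (Finset.univ.filter (fun σ => σ ∈ Δ)).image f,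
      (relBetti R (sublevel Δ f j) (strictSublevel Δ f j) i : MvPolynomial (Fin 2) ℤ) *
        (MvPolynomial.X 1 ^ j * MvPolynomial.X 0 ^ i)

/-- The Poincaré polynomial `P(Δ; q) = ∑ rank H̃_{i-1}(Δ) q ^ i` of a complex `Δ`.  The terms left
out of the finite sum are zero, see `coeff_poincareComplex`. -/
noncomputable def poincareComplex [Fintype S] (Δ : LowerSet (Finset S)) : Polynomial ℤ :=
  ∑ i ∈ Finset.range (Fintype.card S + 1),
    (relBetti R (Δ : Set (Finset S)) ∅ i : Polynomial ℤ) * Polynomial.X ^ i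

theorem relBetti_eq_zero_of_le [Nontrivial R] (K L : Set (Finset S)) (n : ℕ)
    (h : chains R K n ≤ relBoundaries R K L n) : relBetti R K L n = 0 := by
  have h1 : (relBoundaries R K L n).submoduleOf (relCycles R K L n) = ⊤ := by
    rw [Submodule.submoduleOf, Submodule.comap_subtype_eq_top]
    exact inf_le_left.trans h
  have : Subsingleton (RelHomology R K L n) := Submodule.Quotient.subsingleton_iff.2 h1
  exact Module.finrank_zero_of_subsingleton

theorem relBetti_eq_zero_of_card_lt [Nontrivial R] [Fintype S] (K L : Set (Finset S)) (n : ℕ)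
    (h : Fintype.card S < n) : relBetti R K L n = 0 := by
  apply relBetti_eq_zero_of_le
  have : {σ : Finset S | σ ∈ K ∧ σ.card = n} = ∅ := by
    ext σ
    have := σ.card_le_univ
    simp only [Set.mem_ofPred_eq, Set.mem_empty_iff_false, iff_false, not_and]
    intro _ h2
    omega
  rw [chains, this, Finsupp.supported_empty]
  exact bot_le

theorem relBetti_eq_zero_of_self [Nontrivial R] (K : Set (Finset S)) (n : ℕ) : relBetti R K K n = 0 :=
  relBetti_eq_zero_of_le R K K n le_sup_right

open scoped Classical in
theorem coeff_poincare [Nontrivial R] [Fintype S] (Δ : LowerSet (Finset S)) (f : Finset S → ℕ) (i j : ℕ) :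
    (poincare R Δ f).coeff (Finsupp.single 1 j + Finsupp.single 0 i) =
      relBetti R (sublevel Δ f j) (strictSublevel Δ f j) i := by
  have key : ∀ (a b n : ℕ), ((n : MvPolynomial (Fin 2) ℤ) *
      (MvPolynomial.X 1 ^ b * MvPolynomial.X 0 ^ a)).coeff
        (Finsupp.single 1 j + Finsupp.single 0 i) =
          if a = i then if b = j then (n : ℤ) else 0 else 0 := by
    intro a b n
    have h1 : (n : MvPolynomial (Fin 2) ℤ) * (MvPolynomial.X 1 ^ b * MvPolynomial.X 0 ^ a) =
        MvPolynomial.monomial (Finsupp.single 1 b + Finsupp.single 0 a) (n : ℤ) := by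
      rw [MvPolynomial.X_pow_eq_monomial, MvPolynomial.X_pow_eq_monomial,
        MvPolynomial.monomial_mul, ← map_natCast (MvPolynomial.C (σ := Fin 2) (R := ℤ)) n,
        MvPolynomial.C_mul_monomial]
      simp
    rw [h1, MvPolynomial.coeff_monomial]
    have h2 : (Finsupp.single (1 : Fin 2) b + Finsupp.single 0 a =
        Finsupp.single 1 j + Finsupp.single 0 i) ↔ (a = i ∧ b = j) := by
      constructor
      · intro h
        have h0 := DFunLike.congr_fun h 0
        have h1 := DFunLike.congr_fun h 1
        simp at h0 h1
        exact ⟨h0, h1⟩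
      · rintro ⟨rfl, rfl⟩
        rfl
    simp only [h2, ite_and]
  simp only [poincare, MvPolynomial.coeff_sum, key]
  by_cases hi : i ∈ Finset.range (Fintype.card S + 1)
  · rw [Finset.sum_eq_single_of_mem i hi (by
      intro b _ hb
      simp [hb])]
    by_cases hj : j ∈ (Finset.univ.filter (fun σ => σ ∈ Δ)).image f
    · rw [Finset.sum_eq_single_of_mem j hj (by
        intro b _ hb
        simp [hb])]
      simp
    · have : strictSublevel Δ f j = sublevel Δ f j := by
        ext σ
        simp only [Finset.mem_image, Finset.mem_filter, Finset.mem_univ, true_and, not_exists,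
          not_and] at hj
        simp only [strictSublevel, sublevel, Set.mem_ofPred_eq]
        exact and_congr_right fun hσ => ⟨le_of_lt, fun h => lt_of_le_of_ne h (hj σ hσ)⟩
      rw [this, relBetti_eq_zero_of_self]
      apply Finset.sum_eq_zero
      intro b hb
      have : b ≠ j := fun h => hj (h ▸ hb)
      simp [this]
  · rw [relBetti_eq_zero_of_card_lt R _ _ i (by simpa using hi)]
    apply Finset.sum_eq_zero
    intro b hb
    have : b ≠ i := fun h => hi (h ▸ hb)
    simp [this]

theorem coeff_poincareComplex [Nontrivial R] [Fintype S] (Δ : LowerSet (Finset S)) (i : ℕ) :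
    (poincareComplex R Δ).coeff i = relBetti R (Δ : Set (Finset S)) ∅ i := by
  have key : ∀ a n : ℕ, ((n : Polynomial ℤ) * Polynomial.X ^ a).coeff i =
      if i = a then (n : ℤ) else 0 := by
    intro a n
    rw [← map_natCast (Polynomial.C (R := ℤ)) n, Polynomial.coeff_C_mul_X_pow]
  simp only [poincareComplex, Polynomial.finsetSum_coeff, key, Finset.sum_ite_eq]
  split_ifs with h
  · rfl
  · rw [relBetti_eq_zero_of_card_lt R _ _ i (by simpa using h)]
    rfl

end

end SimplicialPair

/-!
The proof is a discrete Morse argument in which every homological statement is reduced to three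
collapses and a count.

*Homology.* An elementary collapse `K ↘ K'` makes the pair `(K, K')` acyclic
(`ElementaryCollapse.relAcyclic`), and this property is transitive. Hence the relative Betti numbers
of a pair do not change when either member is collapsed (`relBetti_eq_of_relAcyclic_left`,
`relBetti_eq_of_relAcyclic_right`). When the faces of `K` outside `L` all have `d` elements, the
relative chain complex sits in a single degree and the Betti number counts these faces
(`relBetti_eq_ncard`). This works over any nontrivial commutative ring.

*Collapsing onto the broken circuit complex.* Match a face `σ` that is not a no-broken circuit by
toggling the largest `x` that is the minimum of a circuit contained in `insert x σ`. Toggling does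
not change this `x`, because a circuit with minimum at least `x` only sees elements above `x`; it
preserves the rank; and the chosen element is monotone in `σ`, which makes the matching acyclic
(`collapsesOnto_of_matching`). So `Δ` collapses onto the broken circuit complex, and `Δ_{≤ j}`
collapses onto `Δ_{< j}` together with the no-broken circuits of rank `j`. These have exactly `j`
elements, which gives `P(r; q, x)`.

*The critical bases.* Extending a no-broken circuit by the least element that keeps it independent
gives a no-broken circuit (`insert_mem_brokenCircuitComplex`). Therefore the facets of the broken
circuit complex are bases, and the lexicographic order on them is a shelling
(`exists_isExchangeable`): the faces whose lexicographically first basis is `B` are those between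
`B` and the set of exchangeable elements of `B`. If `B` is not critical, toggling a nonexchangeable
element matches the faces in this interval, so the complex without its critical bases collapses to
the void complex (`noncriticalComplex_collapsesOnto_bot`). The homology of `Δ` is thus the homology
of the broken circuit complex relative to an acyclic subcomplex whose complement is the set of
critical bases, all of the same cardinality.
-/

namespace SimplicialPair

/-! ### Relative homology under collapses -/

section Homology
variable {R : Type*} [CommRing R] {S : Type*}

theorem mem_chains {K : Set (Finset S)} {n : ℕ} {c : Finset S →₀ R} :
    c ∈ chains R K n ↔ ∀ σ, c σ ≠ 0 → σ ∈ K ∧ σ.card = n := by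
  simp [chains, Finsupp.mem_supported, Set.subset_def]

theorem chains_mono {K L : Set (Finset S)} (h : L ⊆ K) (n : ℕ) : chains R L n ≤ chains R K n :=
  Finsupp.supported_mono fun _ hσ => ⟨h hσ.1, hσ.2⟩

theorem chains_le_supported (K : Set (Finset S)) (n : ℕ) :
    chains R K n ≤ Finsupp.supported R R K :=
  Finsupp.supported_mono fun _ hσ => hσ.1

theorem mem_chains_of_mem_supported {K L : Set (Finset S)} {n : ℕ} {c : Finset S →₀ R}
    (hc : c ∈ chains R K n) (hL : c ∈ Finsupp.supported R R L) : c ∈ chains R L n :=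
  mem_chains.2 fun σ hσ => ⟨hL (Finsupp.mem_support_iff.2 hσ), (mem_chains.1 hc σ hσ).2⟩

theorem ElementaryCollapse.subset {K L : LowerSet (Finset S)} (h : ElementaryCollapse K L) :
    (L : Set (Finset S)) ⊆ K := by
  obtain ⟨σ, τ, -, -, -, -, -, hL⟩ := h
  rw [hL]
  exact Set.sdiff_subset

variable [LinearOrder S]

theorem boundary_apply_boundary (c : Finset S →₀ R) : boundary R (boundary R c) = 0 :=
  LinearMap.congr_fun (boundary_boundary R) c

theorem boundary_single (σ : Finset S) (a : R) :
    boundary R (Finsupp.single σ a) =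
      ∑ x ∈ σ, Finsupp.single (σ.erase x) (a * (-1 : R) ^ (σ.filter (· < x)).card) := by
  simp [boundary, Finsupp.linearCombination_single, Finset.smul_sum]

theorem boundary_mem_chains {K : Set (Finset S)} (hK : IsLowerSet K) {n : ℕ}
    {c : Finset S →₀ R} (hc : c ∈ chains R K (n + 1)) : boundary R c ∈ chains R K n := by
  have hle : chains R K (n + 1) ≤ (chains R K n).comap (boundary R) := by
    rw [chains, Finsupp.supported_eq_span_single, Submodule.span_le]
    rintro _ ⟨σ, ⟨hσ, hn⟩, rfl⟩
    simp only [SetLike.mem_coe, Submodule.mem_comap, boundary_single]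
    refine Submodule.sum_mem _ fun x hx => Finsupp.single_mem_supported R _ ⟨?_, ?_⟩
    · exact hK (Finset.erase_subset x σ) hσ
    · rw [Finset.card_erase_of_mem hx, hn, Nat.add_sub_cancel]
  exact hle hc

theorem boundary_eq_zero_of_mem_chains_zero {K : Set (Finset S)} {c : Finset S →₀ R}
    (hc : c ∈ chains R K 0) : boundary R c = 0 := by
  have hle : chains R K 0 ≤ LinearMap.ker (boundary R) := by
    rw [chains, Finsupp.supported_eq_span_single, Submodule.span_le]
    rintro _ ⟨σ, ⟨-, hn⟩, rfl⟩
    rw [Finset.card_eq_zero] at hn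
    subst hn
    simp [boundary_single]
  exact hle hc

/-- Vanishing of the relative homology of the pair `(K, L)`, spelled out on chains: every relative
cycle is a boundary up to chains of `L`. -/
def RelAcyclic (R : Type*) [CommRing R] (K L : Set (Finset S)) : Prop :=
  ∀ n, ∀ c ∈ chains R K n, boundary R c ∈ Finsupp.supported R R L →
    ∃ e ∈ chains R K (n + 1), c - boundary R e ∈ chains R L n

theorem RelAcyclic.trans {K L M : Set (Finset S)} (hLK : L ⊆ K) (hML : M ⊆ L)
    (hKL : RelAcyclic R K L) (hLM : RelAcyclic R L M) : RelAcyclic R K M := by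
  intro n c hc hb
  obtain ⟨e, he, hce⟩ := hKL n c hc (Finsupp.supported_mono hML hb)
  obtain ⟨e', he', hce'⟩ := hLM n _ hce (by rwa [map_sub, boundary_apply_boundary, sub_zero])
  refine ⟨e + e', add_mem he (chains_mono hLK _ he'), ?_⟩
  rwa [map_add, ← sub_sub]

/-- If `insert x σ` is the only face of `K` properly containing `σ`, it is the only one that
contributes to the coefficient of `σ` in a boundary. -/
theorem boundary_apply_of_free {K : Set (Finset S)} {σ : Finset S} {x : S} (hx : x ∉ σ)
    (hfree : ∀ ρ ∈ K, σ ⊂ ρ → ρ = insert x σ) {c : Finset S →₀ R}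
    (hc : c ∈ Finsupp.supported R R K) :
    boundary R c σ = c (insert x σ) * (-1) ^ (σ.filter (· < x)).card := by
  have hle : Finsupp.supported R R K ≤ LinearMap.eqLocus
      (Finsupp.lapply σ ∘ₗ boundary R)
      (((-1 : R) ^ (σ.filter (· < x)).card) • Finsupp.lapply (insert x σ)) := by
    rw [Finsupp.supported_eq_span_single, Submodule.span_le]
    rintro _ ⟨ρ, hρ, rfl⟩
    simp only [SetLike.mem_coe, LinearMap.mem_eqLocus, LinearMap.comp_apply, Finsupp.lapply_apply,
      boundary_single, LinearMap.smul_apply, Finsupp.finsetSum_apply, one_mul, smul_eq_mul]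
    by_cases hρσ : ρ = insert x σ
    · subst hρσ
      rw [Finset.sum_eq_single_of_mem x (Finset.mem_insert_self x σ)]
      · rw [Finset.erase_insert hx, Finset.filter_insert, if_neg (lt_irrefl x)]
        simp
      · intro y hy hyx
        refine Finsupp.single_eq_of_ne fun h => hx ?_
        rw [h]
        exact Finset.mem_erase.2 ⟨hyx.symm, Finset.mem_insert_self x σ⟩
    · rw [Finsupp.single_eq_of_ne (Ne.symm hρσ), mul_zero]
      refine Finset.sum_eq_zero fun y hy => Finsupp.single_eq_of_ne fun h => hρσ (hfree ρ hρ ?_)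
      rw [h]
      exact Finset.erase_ssubset hy
  have := hle hc
  simp only [LinearMap.mem_eqLocus, LinearMap.comp_apply, Finsupp.lapply_apply,
    LinearMap.smul_apply, smul_eq_mul] at this
  rw [this, mul_comm]

theorem ElementaryCollapse.relAcyclic {K L : LowerSet (Finset S)} (h : ElementaryCollapse K L) :
    RelAcyclic R (K : Set (Finset S)) L := by
  obtain ⟨σ, τ, hσ, hτ, hστ, hcard, hfree, hL⟩ := h
  obtain ⟨x, hx, rfl⟩ : ∃ x, x ∉ σ ∧ τ = insert x σ := by
    obtain ⟨x, hx⟩ : ∃ x, τ \ σ = {x} := by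
      rw [← Finset.card_eq_one, Finset.card_sdiff_of_subset hστ.subset, hcard]
      omega
    have hxm : x ∈ τ \ σ := by rw [hx]; exact Finset.mem_singleton_self x
    refine ⟨x, (Finset.mem_sdiff.1 hxm).2, ?_⟩
    rw [Finset.insert_eq, ← hx, Finset.sdiff_union_of_subset hστ.subset]
  intro n c hc hb
  set ε : R := (-1) ^ (σ.filter (· < x)).card with hε
  have hεε : ε * ε = 1 := by rw [hε, ← mul_pow]; simp
  -- Subtracting a multiple of the boundary of `insert x σ` cancels the coefficient of `σ`; the
  -- coefficient of `insert x σ` then vanishes because the boundary of `c` has none at `σ`.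
  set e : Finset S →₀ R := Finsupp.single (insert x σ) (c σ * ε) with he_def
  have he : e ∈ chains R (K : Set (Finset S)) (n + 1) := by
    by_cases h0 : c σ = 0
    · simp [he_def, h0]
    · refine Finsupp.single_mem_supported R _ ⟨hτ, ?_⟩
      rw [hcard, (mem_chains.1 hc σ h0).2]
  have hce : c - boundary R e ∈ chains R (K : Set (Finset S)) n :=
    sub_mem hc (boundary_mem_chains K.lower he)
  have hcσ : (c - boundary R e) σ = 0 := by
    rw [Finsupp.sub_apply, boundary_apply_of_free hx hfree (chains_le_supported _ _ he), ← hε,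
      he_def, Finsupp.single_eq_same, mul_assoc, hεε, mul_one, sub_self]
  have hcτ : (c - boundary R e) (insert x σ) = 0 := by
    have h1 := boundary_apply_of_free hx hfree (chains_le_supported _ _ hce)
    rw [map_sub, boundary_apply_boundary, sub_zero, ← hε] at h1
    have h2 : boundary R c σ = 0 := by
      by_contra h0
      have : σ ∈ (L : Set (Finset S)) := hb (Finsupp.mem_support_iff.2 h0)
      rw [hL] at this
      exact this.2 (Or.inl rfl)
    rw [h2] at h1
    rw [← mul_one ((c - boundary R e) _), ← hεε, ← mul_assoc, ← h1, zero_mul]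
  refine ⟨e, he, mem_chains.2 fun ρ hρ => ⟨?_, (mem_chains.1 hce ρ hρ).2⟩⟩
  rw [hL]
  refine ⟨(mem_chains.1 hce ρ hρ).1, ?_⟩
  rintro (rfl | rfl)
  · exact hρ hcσ
  · exact hρ hcτ

theorem CollapsesOnto.subset_and_relAcyclic {K L : LowerSet (Finset S)} (h : CollapsesOnto K L) :
    (L : Set (Finset S)) ⊆ K ∧ RelAcyclic R (K : Set (Finset S)) L := by
  induction h with
  | refl => exact ⟨subset_rfl, fun n c hc _ => ⟨0, zero_mem _, by simpa using hc⟩⟩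
  | tail _ h ih =>
    exact ⟨h.subset.trans ih.1, ih.2.trans ih.1 h.subset h.relAcyclic⟩

/-- The inclusion induces an isomorphism of subquotients `Z₁ / B₁ ≃ Z₂ / B₂`. -/
theorem finrank_subquotient_eq {M : Type*} [AddCommGroup M] [Module R M]
    {Z₁ B₁ Z₂ B₂ : Submodule R M} (hZ : Z₁ ≤ Z₂) (hB : B₁ ≤ B₂) (hsurj : Z₂ ≤ Z₁ ⊔ B₂ ⊓ Z₂)
    (hinj : B₂ ⊓ Z₁ ≤ B₁) :
    Module.finrank R (Subquotient Z₁ B₁) = Module.finrank R (Subquotient Z₂ B₂) := by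
  let f : Subquotient Z₁ B₁ →ₗ[R] Subquotient Z₂ B₂ :=
    Submodule.mapQ _ _ (Submodule.inclusion hZ) fun z hz => hB hz
  refine (LinearEquiv.ofBijective f ⟨?_, ?_⟩).finrank_eq
  · rw [← LinearMap.ker_eq_bot, LinearMap.ker_eq_bot']
    intro z hz
    obtain ⟨z, rfl⟩ := Submodule.Quotient.mk_surjective _ z
    change Submodule.Quotient.mk (Submodule.inclusion hZ z) = 0 at hz
    rw [Submodule.Quotient.mk_eq_zero] at hz
    rw [Submodule.Quotient.mk_eq_zero]
    exact hinj ⟨hz, z.2⟩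
  · intro z
    obtain ⟨⟨z, hz⟩, rfl⟩ := Submodule.Quotient.mk_surjective _ z
    obtain ⟨y, hy, b, hb, rfl⟩ := Submodule.mem_sup.1 (hsurj hz)
    refine ⟨Submodule.Quotient.mk ⟨y, hy⟩, ?_⟩
    refine (Submodule.Quotient.eq _).2 ?_
    change y - (y + b) ∈ B₂
    simpa using hb.1

theorem relBoundaries_le_relCycles {K L : Set (Finset S)} (hK : IsLowerSet K) (hL : IsLowerSet L)
    (hLK : L ⊆ K) (n : ℕ) : relBoundaries R K L n ≤ relCycles R K L n := by
  refine sup_le ?_ fun l hl => ⟨chains_mono hLK n hl, ?_⟩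
  · rintro _ ⟨d, hd, rfl⟩
    refine ⟨boundary_mem_chains hK hd, ?_⟩
    simp [boundary_apply_boundary]
  · rw [SetLike.mem_coe, Submodule.mem_comap]
    cases n with
    | zero => simp [boundary_eq_zero_of_mem_chains_zero hl]
    | succ n => exact chains_le_supported _ _ (boundary_mem_chains hL hl)

theorem relBetti_eq_of_relAcyclic_left {K K' L : Set (Finset S)} (hK : IsLowerSet K)
    (hL : IsLowerSet L) (hK' : K' ⊆ K) (hLK : L ⊆ K') (h : RelAcyclic R K K') (n : ℕ) :
    relBetti R K L n = relBetti R K' L n := by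
  symm
  refine finrank_subquotient_eq ?_ ?_ ?_ ?_
  · exact inf_le_inf_right _ (chains_mono hK' n)
  · exact sup_le_sup_right (Submodule.map_mono (chains_mono hK' _)) _
  · rintro c hc
    obtain ⟨e, he, hce⟩ := h n c hc.1 (Finsupp.supported_mono hLK hc.2)
    have hb : boundary R e ∈ relBoundaries R K L n :=
      Submodule.mem_sup_left (Submodule.mem_map_of_mem he)
    refine Submodule.mem_sup.2 ⟨c - boundary R e, ⟨hce, ?_⟩, boundary R e,
      ⟨hb, relBoundaries_le_relCycles hK hL (hLK.trans hK') n hb⟩, sub_add_cancel _ _⟩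
    rw [SetLike.mem_coe, Submodule.mem_comap, map_sub, boundary_apply_boundary, sub_zero]
    exact hc.2
  · rintro b ⟨hb, hbZ⟩
    obtain ⟨_, ⟨d, hd, rfl⟩, l, hl, rfl⟩ := Submodule.mem_sup.1 hb
    have hd' : boundary R d ∈ Finsupp.supported R R K' := by
      have := sub_mem (chains_le_supported _ _ hbZ.1)
        (chains_le_supported _ _ (chains_mono hLK n hl))
      rwa [add_sub_cancel_right] at this
    obtain ⟨e, -, hde⟩ := h (n + 1) d hd hd'
    refine Submodule.mem_sup.2 ⟨boundary R d, ⟨d - boundary R e, hde, ?_⟩, l, hl, rfl⟩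
    rw [map_sub, boundary_apply_boundary, sub_zero]

theorem relBetti_eq_of_relAcyclic_right {K L L' : Set (Finset S)} (hK : IsLowerSet K)
    (hL : IsLowerSet L) (hL' : L' ⊆ L) (hLK : L ⊆ K) (h : RelAcyclic R L L') (n : ℕ) :
    relBetti R K L' n = relBetti R K L n := by
  refine finrank_subquotient_eq ?_ ?_ ?_ ?_
  · exact inf_le_inf_left _ (Submodule.comap_mono (Finsupp.supported_mono hL'))
  · exact sup_le_sup_left (chains_mono hL' _) _
  · rintro c hc
    obtain ⟨e, he, hce⟩ : ∃ e ∈ chains R L n,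
        boundary R c - boundary R e ∈ Finsupp.supported R R L' := by
      cases n with
      | zero => exact ⟨0, zero_mem _, by simp [boundary_eq_zero_of_mem_chains_zero hc.1]⟩
      | succ n =>
        obtain ⟨e, he, hce⟩ := h n (boundary R c)
          (mem_chains_of_mem_supported (boundary_mem_chains hK hc.1) hc.2)
          (by simp [boundary_apply_boundary])
        exact ⟨e, he, chains_le_supported _ _ hce⟩
    have hb : e ∈ relBoundaries R K L n := Submodule.mem_sup_right he
    refine Submodule.mem_sup.2 ⟨c - e, ⟨sub_mem hc.1 (chains_mono hLK n he), ?_⟩, e,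
      ⟨hb, relBoundaries_le_relCycles hK hL hLK n hb⟩, sub_add_cancel _ _⟩
    rwa [SetLike.mem_coe, Submodule.mem_comap, map_sub]
  · rintro b ⟨hb, hbZ⟩
    obtain ⟨_, ⟨d, hd, rfl⟩, l, hl, rfl⟩ := Submodule.mem_sup.1 hb
    have hl' : boundary R l ∈ Finsupp.supported R R L' := by
      have := hbZ.2
      rwa [SetLike.mem_coe, Submodule.mem_comap, map_add, boundary_apply_boundary, zero_add] at this
    obtain ⟨e, he, hle⟩ := h n l hl hl'
    refine Submodule.mem_sup.2 ⟨boundary R (d + e),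
      Submodule.mem_map_of_mem (add_mem hd (chains_mono hLK _ he)), l - boundary R e, hle, ?_⟩
    rw [map_add]
    abel

/-- If the faces of `K` outside `L` all have `d` elements, the relative chain complex is
concentrated in one degree, so the relative homology is free on these faces. -/
theorem relBetti_eq_ncard [Nontrivial R] {K L : Set (Finset S)} (hK : IsLowerSet K)
    (hL : IsLowerSet L) (hLK : L ⊆ K) {d : ℕ} (hd : ∀ σ ∈ K, σ ∉ L → σ.card = d) (n : ℕ) :
    relBetti R K L n = if n = d then (K \ L).ncard else 0 := by
  have hne : ∀ m, m ≠ d → chains R K m ≤ chains R L m := fun m hm =>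
    Finsupp.supported_mono fun σ hσ =>
      ⟨by_contra fun h => hm (hσ.2.symm.trans (hd σ hσ.1 h)), hσ.2⟩
  split_ifs with hn
  swap
  · exact relBetti_eq_zero_of_le R K L n ((hne n hn).trans le_sup_right)
  subst hn
  have hchains : chains R K n = Finsupp.supported R R (K \ L) ⊔ chains R L n := by
    rw [chains, chains, ← Finsupp.supported_union]
    congr 1
    ext σ
    simp only [Set.mem_ofPred_eq, Set.mem_union, Set.mem_sdiff]
    by_cases h : σ ∈ L
    · simp [h, hLK h]
    · simpa [h] using fun hσ => hd σ hσ h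
  have hB : relBoundaries R K L n = chains R L n := by
    refine sup_eq_right.2 ?_
    rintro _ ⟨c, hc, rfl⟩
    exact boundary_mem_chains hL (hne _ (by omega) hc)
  have hZ : relCycles R K L n = chains R K n := by
    refine inf_eq_left.2 fun c hc => ?_
    rw [Submodule.mem_comap]
    cases n with
    | zero => simp [boundary_eq_zero_of_mem_chains_zero hc]
    | succ n =>
      exact chains_le_supported _ _ (hne _ (by omega) (boundary_mem_chains hK hc))
  have hiso := finrank_subquotient_eq (R := R) (Z₁ := Finsupp.supported R R (K \ L)) (B₁ := ⊥)
    (Z₂ := chains R K n) (B₂ := chains R L n) (hchains ▸ le_sup_left) bot_le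
    (by rw [inf_eq_left.2 (chains_mono hLK n)]; exact hchains.le)
    (by
      rw [inf_comm]
      refine le_trans (inf_le_inf_left _ (chains_le_supported L n)) ?_
      rw [← Finsupp.supported_inter, Set.sdiff_inter_self, Finsupp.supported_empty])
  have hbot : Submodule.submoduleOf (⊥ : Submodule R (Finset S →₀ R))
      (Finsupp.supported R R (K \ L)) = ⊥ :=
    LinearMap.ker_eq_bot.2 (Submodule.subtype_injective _)
  have hfin : relBetti R K L n = Module.finrank R (Subquotient (chains R K n) (chains R L n)) := by
    unfold relBetti RelHomology
    rw [hB, hZ]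
  rw [hfin, ← hiso]
  refine (Submodule.quotEquivOfEqBot _ hbot).finrank_eq.trans ?_
  rw [(Finsupp.supportedEquivFinsupp (K \ L)).finrank_eq, Module.finrank, rank_finsupp_self]
  exact (Cardinal.toNat_lift _).trans (Nat.card_coe_set_eq _)

end Homology

/-! ### Collapses from matchings -/

section Matching
variable {S : Type*} [DecidableEq S]

/-- A matching criterion for collapsibility.  The faces outside `L` are matched by adding or
removing the element `a σ`, which only depends on the value at `σ` of a monotone function `g` that
is constant on matched pairs.  The pairs are removed by decreasing value of `g`. -/
theorem collapsesOnto_of_matching [Finite S] {P : Type*} [LinearOrder P]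
    {K L : LowerSet (Finset S)} (hLK : L ≤ K) (g : Finset S → P) (a : Finset S → S)
    (hmono : ∀ σ ρ, σ ∉ L → ρ ∈ K → σ ⊆ ρ → g σ ≤ g ρ)
    (hag : ∀ σ ρ, σ ∈ K → σ ∉ L → ρ ∈ K → ρ ∉ L → g σ = g ρ → a σ = a ρ)
    (hins : ∀ σ ∈ K, σ ∉ L → insert (a σ) σ ∈ K ∧ g (insert (a σ) σ) = g σ)
    (hers : ∀ σ ∈ K, σ ∉ L → σ.erase (a σ) ∉ L ∧ g (σ.erase (a σ)) = g σ) :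
    CollapsesOnto K L := by
  induction hm : ((K : Set (Finset S)) \ L).ncard using Nat.strong_induction_on generalizing K with
  | _ m ih =>
  by_cases hne : ((K : Set (Finset S)) \ L) = ∅
  · have : K = L := le_antisymm (Set.sdiff_eq_empty.1 hne) hLK
    rw [this]
    exact Relation.ReflTransGen.refl
  obtain ⟨τ, ⟨hτK, hτL⟩, hτmax⟩ := Set.exists_max_image ((K : Set (Finset S)) \ L)
    (fun σ => toLex (g σ, σ.card)) (Set.toFinite _) (Set.nonempty_iff_ne_empty.2 hne)
  set x := a τ with hx
  have hxτ : x ∈ τ := by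
    by_contra hxτ
    obtain ⟨h1, h2⟩ := hins τ hτK hτL
    have h3 := hτmax _ ⟨h1, fun h => hτL (L.lower (Finset.subset_insert _ _) h)⟩
    have h4 := Finset.card_insert_of_notMem hxτ
    simp only [Prod.Lex.le_iff, ofLex_toLex, h2, lt_irrefl, true_and, false_or] at h3
    rw [← hx] at h3
    omega
  obtain ⟨hσL, hgσ⟩ := hers τ hτK hτL
  have hσK : τ.erase x ∈ K := K.lower (Finset.erase_subset x τ) hτK
  have hfree : ∀ ρ ∈ K, τ.erase x ⊂ ρ → ρ = τ := by
    intro ρ hρK hσρ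
    have hρL : ρ ∉ L := fun h => hσL (L.lower hσρ.subset h)
    have hle : g ρ ≤ g τ := by
      have := hτmax ρ ⟨hρK, hρL⟩
      rw [Prod.Lex.le_iff] at this
      rcases this with h | h
      · exact h.le
      · exact h.1.le
    have hgρ : g ρ = g τ := le_antisymm hle (hgσ ▸ hmono _ _ hσL hρK hσρ.subset)
    have haρ : a ρ = x := hag ρ τ hρK hρL hτK hτL hgρ
    obtain ⟨h1, h2⟩ := hins ρ hρK hρL
    rw [haρ] at h1 h2
    have hsub : τ ⊆ insert x ρ := by
      rw [← Finset.insert_erase hxτ]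
      exact Finset.insert_subset_insert x hσρ.subset
    have h3 := hτmax _ ⟨h1, fun h => hτL (L.lower hsub h)⟩
    simp only [Prod.Lex.le_iff, ofLex_toLex, h2, hgρ, lt_irrefl, true_and, false_or] at h3
    have heq : τ = insert x ρ := Finset.eq_of_subset_of_card_le hsub h3
    by_cases hxρ : x ∈ ρ
    · rw [heq, Finset.insert_eq_of_mem hxρ]
    · exact absurd hσρ (by rw [heq, Finset.erase_insert hxρ]; exact ssubset_irrefl ρ)
  have hστ : τ.erase x ⊂ τ := Finset.erase_ssubset hxτ
  let K' : LowerSet (Finset S) :=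
    { carrier := (K : Set (Finset S)) \ {τ.erase x, τ}
      lower' := by
        intro ρ ρ' hle hρ
        refine ⟨K.lower hle hρ.1, ?_⟩
        rintro (rfl | rfl)
        · rcases hle.eq_or_lt with h | h
          · exact hρ.2 (Or.inl h.symm)
          · exact hρ.2 (Or.inr (hfree ρ hρ.1 h))
        · exact hρ.2 (Or.inr (hfree ρ hρ.1 (lt_of_lt_of_le hστ hle))) }
  have hmem : ∀ ρ, ρ ∈ K' ↔ ρ ∈ K ∧ ρ ≠ τ.erase x ∧ ρ ≠ τ := by
    intro ρ
    change ρ ∈ (K : Set (Finset S)) \ {τ.erase x, τ} ↔ _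
    simp [not_or]
  have hcol : ElementaryCollapse K K' :=
    ⟨τ.erase x, τ, hσK, hτK, hστ, (Finset.card_erase_add_one hxτ).symm, hfree, rfl⟩
  have hK'K : ∀ ρ, ρ ∈ K' → ρ ∈ K := fun ρ h => ((hmem ρ).1 h).1
  refine Relation.ReflTransGen.head hcol (ih _ ?_ ?_ ?_ ?_ ?_ ?_ rfl)
  · rw [← hm]
    refine Set.ncard_lt_ncard ⟨Set.sdiff_subset_sdiff_left hK'K, fun h => ?_⟩ (Set.toFinite _)
    exact ((hmem τ).1 (h ⟨hτK, hτL⟩).1).2.2 rfl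
  · intro ρ hρ
    refine (hmem ρ).2 ⟨hLK hρ, ?_, ?_⟩
    · rintro rfl; exact hσL hρ
    · rintro rfl; exact hτL hρ
  · exact fun σ ρ h1 h2 => hmono σ ρ h1 (hK'K ρ h2)
  · exact fun σ ρ h1 h2 h3 h4 => hag σ ρ (hK'K σ h1) h2 (hK'K ρ h3) h4
  · intro σ hσ hσL'
    obtain ⟨h1, h2, h3⟩ := (hmem σ).1 hσ
    obtain ⟨h4, h5⟩ := hins σ h1 hσL'
    refine ⟨(hmem _).2 ⟨h4, fun h => ?_, fun h => ?_⟩, h5⟩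
    · have hax : a σ = x := by
        refine hag σ τ h1 hσL' hτK hτL ?_
        rw [← h5, h, hgσ]
      have : x ∈ τ.erase x := h ▸ hax ▸ Finset.mem_insert_self _ _
      exact Finset.notMem_erase x τ this
    · have hax : a σ = x := by
        refine hag σ τ h1 hσL' hτK hτL ?_
        rw [← h5, h]
      rw [hax] at h
      by_cases hxσ : x ∈ σ
      · exact h3 (by rw [← h, Finset.insert_eq_of_mem hxσ])
      · exact h2 (by rw [← h, Finset.erase_insert hxσ])
  · exact fun σ hσ => hers σ (hK'K σ hσ)

end Matching

end SimplicialPair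

namespace Semimatroid

/-! ### Rank, independence and circuits of a semimatroid -/

section Rank
variable {S : Type*} [DecidableEq S] {C : Semimatroid S}

theorem isIndependent_iff {σ : Finset S} :
    C.IsIndependent σ ↔ σ ∈ C.complex ∧ C.rank σ = σ.card := by
  refine and_congr_right fun h => ?_
  have := C.rank_le_card σ h
  omega

theorem rank_le_add_card_sdiff {σ τ : Finset S} (hσ : σ ∈ C.complex) (hτ : τ ⊆ σ) :
    C.rank σ ≤ C.rank τ + (σ \ τ).card := by
  have hd : σ \ τ ∈ C.complex := C.complex.lower Finset.sdiff_subset hσ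
  have h := C.rank_submodular τ (C.complex.lower hτ hσ) (σ \ τ) hd
  rw [Finset.union_sdiff_of_subset hτ] at h
  have := C.rank_le_card _ hd
  have := h hσ
  omega

theorem IsIndependent.subset {σ τ : Finset S} (hσ : C.IsIndependent σ) (hτ : τ ⊆ σ) :
    C.IsIndependent τ := by
  rw [isIndependent_iff] at hσ ⊢
  have h1 := C.complex.lower hτ hσ.1
  have h2 := rank_le_add_card_sdiff hσ.1 hτ
  have h3 := Finset.card_sdiff_add_card_eq_card hτ
  have h4 := C.rank_le_card τ h1
  exact ⟨h1, by omega⟩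

theorem isDependent_of_not_isIndependent {σ : Finset S} (hσ : σ ∈ C.complex)
    (h : ¬ C.IsIndependent σ) : C.IsDependent σ :=
  ⟨hσ, not_not.1 fun h' => h ⟨hσ, h'⟩⟩

theorem IsCircuit.not_subset {c σ : Finset S} (hc : C.IsCircuit c) (hσ : C.IsIndependent σ) :
    ¬ c ⊆ σ :=
  fun h => (hσ.subset h).2 hc.prop.2

theorem IsCircuit.rank_erase {c : Finset S} (hc : C.IsCircuit c) {x : S} (hx : x ∈ c) :
    C.rank (c.erase x) = C.rank c := by
  have hmem : c.erase x ∈ C.complex := C.complex.lower (Finset.erase_subset x c) hc.prop.1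
  have hind : C.IsIndependent (c.erase x) := by
    by_contra h
    have := hc.le_of_le (isDependent_of_not_isIndependent hmem h) (Finset.erase_subset x c)
    exact Finset.notMem_erase x c (this hx)
  have h1 := (isIndependent_iff.1 hind).2
  have h2 := Finset.card_erase_add_one hx
  have h3 := hc.prop.2
  have h4 := C.rank_mono _ hmem _ hc.prop.1 (Finset.erase_subset x c)
  omega

/-- Adding to a face the missing element of a circuit yields a face of the same rank. -/
theorem IsCircuit.insert_mem {c : Finset S} (hc : C.IsCircuit c) {x : S} (hx : x ∈ c)
    {σ : Finset S} (hσ : σ ∈ C.complex) (hcσ : c.erase x ⊆ σ) :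
    insert x σ ∈ C.complex ∧ C.rank (insert x σ) = C.rank σ := by
  by_cases hxσ : x ∈ σ
  · rw [Finset.insert_eq_of_mem hxσ]
    exact ⟨hσ, rfl⟩
  have hinter : c ∩ σ = c.erase x := by
    refine Finset.Subset.antisymm (fun y hy => ?_) fun y hy =>
      Finset.mem_inter.2 ⟨Finset.mem_of_mem_erase hy, hcσ hy⟩
    rw [Finset.mem_inter] at hy
    exact Finset.mem_erase.2 ⟨fun h => hxσ (h ▸ hy.2), hy.1⟩
  have hunion : c ∪ σ = insert x σ := by
    rw [← Finset.insert_erase hx, Finset.insert_union, Finset.union_eq_right.2 hcσ]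
  have hr := hc.rank_erase hx
  have hmem : insert x σ ∈ C.complex := by
    rw [← hunion]
    exact C.union_mem c hc.prop.1 σ hσ (by rw [hinter, hr])
  have h1 := C.rank_submodular c hc.prop.1 σ hσ (by rwa [hunion])
  rw [hinter, hunion, hr] at h1
  have h2 := C.rank_mono σ hσ _ hmem (Finset.subset_insert x σ)
  exact ⟨hmem, by omega⟩

theorem exists_isCircuit_subset {σ : Finset S} (hσ : C.IsDependent σ) :
    ∃ c ⊆ σ, C.IsCircuit c :=
  exists_minimal_le_of_wellFoundedLT C.IsDependent σ hσ

/-- The augmentation property of independent faces.  The axiom `exists_insert_mem` does not say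
that the rank grows; it is applied to a maximal face of rank `rank σ` between `σ` and `σ ∪ τ`. -/
theorem IsIndependent.exists_insert [Finite S] {σ τ : Finset S} (hσ : C.IsIndependent σ)
    (hτ : C.IsIndependent τ) (hcard : σ.card < τ.card) :
    ∃ y ∈ τ \ σ, C.IsIndependent (insert y σ) := by
  by_contra! hcon
  rw [isIndependent_iff] at hσ hτ
  obtain ⟨ρ, hσρ, hρ⟩ := exists_maximal_ge_of_wellFoundedGT
    (fun ρ : Finset S => σ ⊆ ρ ∧ ρ ∈ C.complex ∧ C.rank ρ = C.rank σ) σ ⟨subset_rfl, hσ.1, rfl⟩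
  obtain ⟨-, hρΔ, hρr⟩ := hρ.prop
  obtain ⟨y, hy, hyρ⟩ := C.exists_insert_mem ρ hρΔ τ hτ.1 (by omega)
  rw [Finset.mem_sdiff] at hy
  have hyσ : y ∉ σ := fun h => hy.2 (hσρ h)
  have hmem : insert y σ ∈ C.complex := C.complex.lower (Finset.insert_subset_insert y hσρ) hyρ
  have hr : C.rank (insert y σ) < (insert y σ).card :=
    (isDependent_of_not_isIndependent hmem (hcon y (Finset.mem_sdiff.2 ⟨hy.1, hyσ⟩))).2
  rw [Finset.card_insert_of_notMem hyσ] at hr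
  have hinter : ρ ∩ insert y σ = σ := by
    rw [Finset.inter_insert_of_notMem hy.2, Finset.inter_eq_right.2 hσρ]
  have hunion : ρ ∪ insert y σ = insert y ρ := by
    rw [Finset.union_insert, Finset.union_eq_left.2 hσρ]
  have h1 := C.rank_submodular ρ hρΔ _ hmem (by rwa [hunion])
  rw [hinter, hunion] at h1
  have h2 := C.rank_mono ρ hρΔ _ hyρ (Finset.subset_insert y ρ)
  have h3 := hρ.le_of_ge (y := insert y ρ)
    ⟨hσρ.trans (Finset.subset_insert y ρ), hyρ, by omega⟩ (Finset.subset_insert y ρ)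
  exact hy.2 (h3 (Finset.mem_insert_self y ρ))

theorem IsBasis.card_le [Finite S] {B σ : Finset S} (hB : C.IsBasis B) (hσ : C.IsIndependent σ) :
    σ.card ≤ B.card := by
  by_contra! h
  obtain ⟨y, hy, hyB⟩ := hB.prop.exists_insert hσ h
  exact (Finset.mem_sdiff.1 hy).2
    (hB.le_of_ge hyB (Finset.subset_insert y B) (Finset.mem_insert_self y B))

theorem IsBasis.of_card_eq [Finite S] {B σ : Finset S} (hB : C.IsBasis B) (hσ : C.IsIndependent σ)
    (hcard : σ.card = B.card) : C.IsBasis σ :=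
  ⟨hσ, fun _ hτ hle => (Finset.eq_of_subset_of_card_le hle (hcard ▸ hB.card_le hτ)).ge⟩

end Rank

/-! ### The lexicographic order on finite sets -/

section Lex
variable {S : Type*}

/-- The lexicographic order on finite sets in which the earlier set, the one containing the
smallest element of the symmetric difference, is the larger one.  It is the colexicographic order
for the reversed order on `S`. -/
def lexKey (B : Finset S) : Colex (Finset Sᵒᵈ) :=
  toColex (B.map OrderDual.toDual.toEmbedding)

theorem lexKey_injective : Function.Injective (lexKey (S := S)) := fun _ _ h =>
  Finset.map_injective _ (toColex_inj.1 h)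

variable [LinearOrder S]

theorem lexKey_lt_iff {A B : Finset S} :
    lexKey A < lexKey B ↔ ∃ y ∈ B, y ∉ A ∧ ∀ x ∈ A, x ∉ B → y < x := by
  rw [lexKey, lexKey, Finset.Colex.toColex_lt_toColex_iff_exists_forall_lt]
  simp

theorem lexKey_lt_exchange {B : Finset S} {x y : S} (hyx : y < x) (hy : y ∉ B) :
    lexKey B < lexKey (insert y (B.erase x)) := by
  refine lexKey_lt_iff.2 ⟨y, Finset.mem_insert_self _ _, hy, fun z hz hz' => ?_⟩
  have : z = x := by
    by_contra h
    exact hz' (Finset.mem_insert_of_mem (Finset.mem_erase.2 ⟨h, hz⟩))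
  exact this ▸ hyx

end Lex

/-! ### No-broken circuits -/

section BrokenCircuit
variable {S : Type*} [LinearOrder S] {C : Semimatroid S}

theorem brokenCircuitComplex_le : C.brokenCircuitComplex ≤ C.complex := fun _ h => h.1

theorem IsCircuit.nonempty {c : Finset S} (hc : C.IsCircuit c) : c.Nonempty := by
  rw [← Finset.card_pos]
  exact lt_of_le_of_lt (Nat.zero_le _) hc.prop.2

theorem mem_brokenCircuitComplex_iff {σ : Finset S} : σ ∈ C.brokenCircuitComplex ↔
    σ ∈ C.complex ∧ ∀ c (hc : C.IsCircuit c), ¬ c.erase (c.min' hc.nonempty) ⊆ σ := by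
  refine and_congr_right fun _ => ⟨fun h c hc => h _ ⟨c, hc, hc.nonempty, rfl⟩, ?_⟩
  rintro h _ ⟨c, hc, _, rfl⟩
  exact h c hc

theorem isIndependent_of_mem_brokenCircuitComplex [Finite S] {σ : Finset S}
    (hσ : σ ∈ C.brokenCircuitComplex) : C.IsIndependent σ := by
  rw [mem_brokenCircuitComplex_iff] at hσ
  by_contra h
  obtain ⟨c, hcσ, hc⟩ := exists_isCircuit_subset (isDependent_of_not_isIndependent hσ.1 h)
  exact hσ.2 c hc ((Finset.erase_subset _ c).trans hcσ)

theorem rank_eq_card_of_mem_brokenCircuitComplex [Finite S] {σ : Finset S}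
    (hσ : σ ∈ C.brokenCircuitComplex) : C.rank σ = σ.card :=
  (isIndependent_iff.1 (isIndependent_of_mem_brokenCircuitComplex hσ)).2

/-! ### Collapsing onto the broken circuit complex -/

/-- The elements `x` for which some circuit with smallest element `x` lies in `insert x σ`.  These
are the elements that depend on the larger elements of `σ`. -/
def externallyActive (C : Semimatroid S) (σ : Finset S) : Set S :=
  {x | ∃ c, ∃ hc : C.IsCircuit c, x = c.min' hc.nonempty ∧ c.erase x ⊆ σ}

theorem externallyActive_mono {σ τ : Finset S} (h : σ ⊆ τ) :
    C.externallyActive σ ⊆ C.externallyActive τ := by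
  rintro x ⟨c, hc, hx, hcσ⟩
  exact ⟨c, hc, hx, hcσ.trans h⟩

theorem externallyActive_nonempty {σ : Finset S} (hσ : σ ∈ C.complex)
    (hbc : σ ∉ C.brokenCircuitComplex) : (C.externallyActive σ).Nonempty := by
  simp only [mem_brokenCircuitComplex_iff, hσ, true_and, not_forall, not_not] at hbc
  obtain ⟨c, hc, h⟩ := hbc
  exact ⟨_, c, hc, rfl, h⟩

theorem notMem_brokenCircuitComplex_of_externallyActive {σ : Finset S}
    (h : (C.externallyActive σ).Nonempty) : σ ∉ C.brokenCircuitComplex := by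
  obtain ⟨_, c, hc, rfl, hcσ⟩ := h
  exact fun hσ => (mem_brokenCircuitComplex_iff.1 hσ).2 c hc hcσ

/-- Toggling an element `x` does not affect the externally active elements above `x`, nor the
activity of `x` itself. -/
theorem mem_externallyActive_of_insert {σ : Finset S} {x z : S} (hxz : x ≤ z)
    (hz : z ∈ C.externallyActive (insert x σ)) : z ∈ C.externallyActive (σ.erase x) := by
  obtain ⟨c, hc, rfl, hcσ⟩ := hz
  refine ⟨c, hc, rfl, fun y hy => ?_⟩
  have hzy : c.min' hc.nonempty < y :=
    lt_of_le_of_ne (Finset.min'_le _ _ (Finset.mem_of_mem_erase hy))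
      (Finset.ne_of_mem_erase hy).symm
  have hyx : y ≠ x := (hxz.trans_lt hzy).ne'
  exact Finset.mem_erase.2 ⟨hyx, (Finset.mem_insert.1 (hcσ hy)).resolve_left hyx⟩

theorem insert_mem_of_mem_externallyActive {σ : Finset S} (hσ : σ ∈ C.complex) {x : S}
    (hx : x ∈ C.externallyActive σ) :
    insert x σ ∈ C.complex ∧ C.rank (insert x σ) = C.rank σ := by
  obtain ⟨c, hc, rfl, hcσ⟩ := hx
  exact hc.insert_mem (Finset.min'_mem _ _) hσ hcσ

/-- Toggling the largest externally active element collapses `K` onto `L`, provided that all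
no-broken circuits of `K` lie in `L`, that membership in `K` depends on the rank only, and that
membership in `L` depends on the rank only for faces that are not no-broken circuits.  This covers
both `Δ` with its broken circuit complex and the pieces of the filtration of `Δ` by rank. -/
theorem collapsesOnto_of_rank [Finite S] {K L : LowerSet (Finset S)} (hKΔ : K ≤ C.complex)
    (hLK : L ≤ K)
    (hbc : ∀ σ ∈ K, σ ∈ C.brokenCircuitComplex → σ ∈ L)
    (hK : ∀ σ ∈ K, ∀ τ ∈ C.complex, C.rank τ = C.rank σ → τ ∈ K)
    (hL : ∀ σ ∈ L, ∀ τ ∈ C.complex, τ ∉ C.brokenCircuitComplex → σ ∉ C.brokenCircuitComplex →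
      C.rank τ = C.rank σ → τ ∈ L) :
    SimplicialPair.CollapsesOnto K L := by
  by_cases hne : K ≤ L
  · rw [le_antisymm hLK hne]
    exact Relation.ReflTransGen.refl
  obtain ⟨σ₀, hσ₀, hσ₀L⟩ : ∃ σ ∈ K, σ ∉ L := Set.not_subset.1 hne
  have hact : ∀ σ ∈ K, σ ∉ L → (C.externallyActive σ).Nonempty := fun σ hσ hσL =>
    externallyActive_nonempty (hKΔ hσ) fun h => hσL (hbc σ hσ h)
  have hmax : ∀ σ : Finset S, ∃ x, (C.externallyActive σ).Nonempty →
      IsGreatest (C.externallyActive σ) x := by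
    intro σ
    by_cases h : (C.externallyActive σ).Nonempty
    · obtain ⟨x, hx, hx'⟩ := Set.exists_max_image _ id (Set.toFinite _) h
      exact ⟨x, fun _ => ⟨hx, hx'⟩⟩
    · obtain ⟨x, -⟩ := hact σ₀ hσ₀ hσ₀L
      exact ⟨x, fun h' => absurd h' h⟩
  choose a ha using hmax
  have hers : ∀ σ, (C.externallyActive σ).Nonempty →
      IsGreatest (C.externallyActive (σ.erase (a σ))) (a σ) := fun σ h =>
    ⟨mem_externallyActive_of_insert le_rfl
      (externallyActive_mono (Finset.subset_insert _ _) (ha σ h).1),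
      fun z hz => (ha σ h).2 (externallyActive_mono (Finset.erase_subset _ _) hz)⟩
  have hins : ∀ σ, (C.externallyActive σ).Nonempty →
      IsGreatest (C.externallyActive (insert (a σ) σ)) (a σ) := by
    refine fun σ h => ⟨externallyActive_mono (Finset.subset_insert _ _) (ha σ h).1, fun z hz => ?_⟩
    by_contra! hlt
    exact hlt.not_ge ((hers σ h).2 (mem_externallyActive_of_insert hlt.le hz))
  have haeq : ∀ σ x, IsGreatest (C.externallyActive σ) x → a σ = x := fun σ x h =>
    (ha σ ⟨x, h.1⟩).unique h
  refine SimplicialPair.collapsesOnto_of_matching hLK a a ?_ (fun _ _ _ _ _ _ h => h) ?_ ?_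
  · intro σ ρ hσL hρ hσρ
    have hσ := hact σ (K.lower hσρ hρ) hσL
    have hle := externallyActive_mono (C := C) hσρ
    exact (ha ρ (hσ.mono hle)).2 (hle (ha σ hσ).1)
  · intro σ hσ hσL
    have h := hact σ hσ hσL
    obtain ⟨h1, h2⟩ := insert_mem_of_mem_externallyActive (hKΔ hσ) (ha σ h).1
    exact ⟨hK σ hσ _ h1 h2, haeq _ _ (hins σ h)⟩
  · intro σ hσ hσL
    have h := hact σ hσ hσL
    have h1 := hers σ h
    refine ⟨fun hmem => hσL ?_, haeq _ _ h1⟩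
    have hmemΔ := hKΔ (hLK hmem)
    obtain ⟨h2, h3⟩ := insert_mem_of_mem_externallyActive hmemΔ h1.1
    have h4 : insert (a σ) (σ.erase (a σ)) ∈ L :=
      hL _ hmem _ h2 (notMem_brokenCircuitComplex_of_externallyActive
        ⟨_, externallyActive_mono (Finset.subset_insert _ _) h1.1⟩)
        (notMem_brokenCircuitComplex_of_externallyActive ⟨_, h1.1⟩) h3
    refine L.lower (fun y hy => ?_) h4
    by_cases hy' : y = a σ
    · exact hy' ▸ Finset.mem_insert_self _ _
    · exact Finset.mem_insert_of_mem (Finset.mem_erase.2 ⟨hy', hy⟩)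

theorem collapsesOnto_brokenCircuitComplex [Finite S] (C : Semimatroid S) :
    SimplicialPair.CollapsesOnto C.complex C.brokenCircuitComplex :=
  collapsesOnto_of_rank le_rfl brokenCircuitComplex_le (fun _ _ h => h) (fun _ _ _ h _ => h)
    fun _ hσ _ _ _ h => absurd hσ h

/-! ### Shelling of the broken circuit complex -/

/-- Extending a no-broken circuit greedily, by the smallest element that keeps it independent,
yields a no-broken circuit. -/
theorem insert_mem_brokenCircuitComplex {τ : Finset S} {y : S} (hτ : τ ∈ C.brokenCircuitComplex)
    (hyτ : y ∉ τ) (hy : C.IsIndependent (insert y τ))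
    (hmin : ∀ z, z ∉ τ → C.IsIndependent (insert z τ) → y ≤ z) :
    insert y τ ∈ C.brokenCircuitComplex := by
  refine mem_brokenCircuitComplex_iff.2 ⟨hy.1, fun c hc hcy => ?_⟩
  set z := c.min' hc.nonempty with hz
  have hzc : z ∈ c := Finset.min'_mem _ _
  have hzy : z ∉ insert y τ := fun h => hc.not_subset hy fun x hx => by
    by_cases hxz : x = z
    · exact hxz ▸ h
    · exact hcy (Finset.mem_erase.2 ⟨hxz, hx⟩)
  rw [Finset.mem_insert, not_or] at hzy
  have hyc : y ∈ c := by
    by_contra hyc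
    refine (mem_brokenCircuitComplex_iff.1 hτ).2 c hc fun x hx => ?_
    refine (Finset.mem_insert.1 (hcy hx)).resolve_left ?_
    rintro rfl
    exact hyc (Finset.mem_of_mem_erase hx)
  have hlt : z < y := lt_of_le_of_ne (Finset.min'_le _ _ hyc) hzy.1
  -- By minimality of `y` the smaller element `z` is spanned by `τ`; then so is `y`.
  have hzτ : ¬ C.IsIndependent (insert z τ) := fun h => hlt.not_ge (hmin z hzy.2 h)
  obtain ⟨h1, h2⟩ := hc.insert_mem hzc hy.1 hcy
  have hzΔ : insert z τ ∈ C.complex :=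
    C.complex.lower (Finset.insert_subset_insert z (Finset.subset_insert y τ)) h1
  have hcyz : c.erase y ⊆ insert z τ := by
    intro x hx
    rw [Finset.mem_erase] at hx
    by_cases hxz : x = z
    · exact hxz ▸ Finset.mem_insert_self _ _
    · exact Finset.mem_insert_of_mem
        ((Finset.mem_insert.1 (hcy (Finset.mem_erase.2 ⟨hxz, hx.2⟩))).resolve_left hx.1)
  have h3 := (hc.insert_mem hyc hzΔ hcyz).2
  rw [Finset.insert_comm, h2, (isIndependent_iff.1 hy).2, Finset.card_insert_of_notMem hyτ] at h3
  have h4 := (isDependent_of_not_isIndependent hzΔ hzτ).2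
  rw [Finset.card_insert_of_notMem hzy.2] at h4
  omega

theorem exists_insert_mem_brokenCircuitComplex [Finite S] {τ : Finset S} {y : S}
    (hτ : τ ∈ C.brokenCircuitComplex) (hyτ : y ∉ τ) (hy : C.IsIndependent (insert y τ)) :
    ∃ z ≤ y, z ∉ τ ∧ insert z τ ∈ C.brokenCircuitComplex := by
  obtain ⟨z, ⟨hzτ, hz⟩, hmin⟩ := Set.exists_min_image
    {z | z ∉ τ ∧ C.IsIndependent (insert z τ)} id (Set.toFinite _) ⟨y, hyτ, hy⟩
  exact ⟨z, hmin y ⟨hyτ, hy⟩, hzτ, insert_mem_brokenCircuitComplex hτ hzτ hz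
    fun w h1 h2 => hmin w ⟨h1, h2⟩⟩

theorem exists_isBasis_superset [Finite S] {σ : Finset S} (hσ : σ ∈ C.brokenCircuitComplex) :
    ∃ B, σ ⊆ B ∧ B ∈ C.brokenCircuitComplex ∧ C.IsBasis B := by
  obtain ⟨B, hσB, hB⟩ := exists_maximal_ge_of_wellFoundedGT (· ∈ C.brokenCircuitComplex) σ hσ
  have hind := isIndependent_of_mem_brokenCircuitComplex hB.prop
  refine ⟨B, hσB, hB.prop, hind, fun τ hτ hBτ => ?_⟩
  intro y hy
  by_contra hyB
  obtain ⟨z, -, hzB, hz⟩ := exists_insert_mem_brokenCircuitComplex hB.prop hyB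
    (hτ.subset (Finset.insert_subset hy hBτ))
  exact hzB (hB.le_of_ge hz (Finset.subset_insert z B) (Finset.mem_insert_self z B))

/-- The element `x` of a no-broken circuit can be exchanged for a smaller one. -/
def IsExchangeable (C : Semimatroid S) (σ : Finset S) (x : S) : Prop :=
  ∃ y, y < x ∧ y ∉ σ ∧ insert y (σ.erase x) ∈ C.brokenCircuitComplex

/-- The shelling property of the lexicographic order on the no-broken circuit bases: if `B'`
precedes `B`, then some element of `B \ B'` is exchangeable in `B`. -/
theorem exists_isExchangeable [Finite S] {B B' : Finset S} (hB : C.IsBasis B)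
    (hBbc : B ∈ C.brokenCircuitComplex) (hB' : C.IsIndependent B') {y : S} (hyB' : y ∈ B')
    (hyB : y ∉ B) (hlex : ∀ x ∈ B, x ∉ B' → y < x) :
    ∃ x ∈ B, x ∉ B' ∧ C.IsExchangeable B x := by
  have hstart : C.IsIndependent (insert y (B ∩ B')) :=
    hB'.subset (Finset.insert_subset hyB' Finset.inter_subset_right)
  obtain ⟨D, hD0, hD⟩ := exists_maximal_ge_of_wellFoundedGT
    (fun D : Finset S => C.IsIndependent D ∧ D ⊆ insert y B) (insert y (B ∩ B'))
    ⟨hstart, Finset.insert_subset_insert y Finset.inter_subset_left⟩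
  obtain ⟨hDind, hDB⟩ := hD.prop
  have hyD : y ∈ D := hD0 (Finset.mem_insert_self _ _)
  have hcard : B.card ≤ D.card := by
    by_contra! h
    obtain ⟨b, hb, hbD⟩ := hDind.exists_insert hB.prop h
    rw [Finset.mem_sdiff] at hb
    exact hb.2 (hD.le_of_ge (y := insert b D)
      ⟨hbD, Finset.insert_subset (Finset.mem_insert_of_mem hb.1) hDB⟩
      (Finset.subset_insert b D) (Finset.mem_insert_self b D))
  obtain ⟨x, hxB, hxD⟩ : ∃ x ∈ B, x ∉ D := by
    by_contra! h
    have h1 := Finset.card_le_card (Finset.insert_subset hyD h)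
    rw [Finset.card_insert_of_notMem hyB] at h1
    have := hB.card_le hDind
    omega
  have hxB' : x ∉ B' := fun h =>
    hxD (hD0 (Finset.mem_insert_of_mem (Finset.mem_inter.2 ⟨hxB, h⟩)))
  have hyx := hlex x hxB hxB'
  have hyE : y ∉ B.erase x := fun h => hyB (Finset.mem_of_mem_erase h)
  have hsub : D ⊆ insert y (B.erase x) := by
    intro z hz
    rcases Finset.mem_insert.1 (hDB hz) with h | h
    · exact h ▸ Finset.mem_insert_self _ _
    · exact Finset.mem_insert_of_mem (Finset.mem_erase.2 ⟨fun h' => hxD (h' ▸ hz), h⟩)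
  have hDeq : D = insert y (B.erase x) := by
    refine Finset.eq_of_subset_of_card_le hsub ?_
    rw [Finset.card_insert_of_notMem hyE, Finset.card_erase_add_one hxB]
    exact hcard
  obtain ⟨z, hzy, hzE, hz⟩ := exists_insert_mem_brokenCircuitComplex
    (C.brokenCircuitComplex.lower (Finset.erase_subset x B) hBbc) hyE (hDeq ▸ hDind)
  have hzx := hzy.trans_lt hyx
  exact ⟨x, hxB, hxB', z, hzx, fun h => hzE (Finset.mem_erase.2 ⟨hzx.ne, h⟩), hz⟩

/-! ### Collapsing the noncritical part of the broken circuit complex -/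

/-- The broken circuit complex without the critical bases. -/
def noncriticalComplex [Finite S] (C : Semimatroid S) : LowerSet (Finset S) where
  carrier := {σ | σ ∈ C.brokenCircuitComplex ∧ ¬ (C.IsCritical σ ∧ C.IsBasis σ)}
  lower' := by
    rintro σ τ hle ⟨hσ, hσc⟩
    refine ⟨C.brokenCircuitComplex.lower hle hσ, fun ⟨hτ, hτB⟩ => hσc ?_⟩
    have := hτB.eq_of_ge (isIndependent_of_mem_brokenCircuitComplex hσ) hle
    exact this ▸ ⟨hτ, hτB⟩

/-- Among the bases that are no-broken circuits and contain a face `σ` there is a lexicographically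
first one, `B`; the matching toggles an element of `B` that is not exchangeable. -/
theorem noncriticalComplex_collapsesOnto_bot [Finite S] (C : Semimatroid S) :
    SimplicialPair.CollapsesOnto C.noncriticalComplex ⊥ := by
  by_cases hne : C.noncriticalComplex ≤ ⊥
  · rw [le_bot_iff.1 hne]
    exact Relation.ReflTransGen.refl
  obtain ⟨σ₀, hσ₀, -⟩ := Set.not_subset.1 hne
  have hfirst : ∀ σ ∈ C.brokenCircuitComplex, ∃ B, (B ∈ C.brokenCircuitComplex ∧ C.IsBasis B ∧
      σ ⊆ B) ∧ ∀ B', B' ∈ C.brokenCircuitComplex → C.IsBasis B' → σ ⊆ B' →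
        lexKey B' ≤ lexKey B := by
    intro σ hσ
    obtain ⟨B₀, h1, h2, h3⟩ := exists_isBasis_superset hσ
    obtain ⟨B, hB, hmax⟩ := Set.exists_max_image
      {B | B ∈ C.brokenCircuitComplex ∧ C.IsBasis B ∧ σ ⊆ B} lexKey (Set.toFinite _)
      ⟨B₀, h2, h3, h1⟩
    exact ⟨B, hB, fun B' h1 h2 h3 => hmax B' ⟨h1, h2, h3⟩⟩
  choose! f hf hfmax using hfirst
  have hexch : ∀ σ ∈ C.brokenCircuitComplex, ∀ x ∈ f σ, x ∉ σ → ¬ C.IsExchangeable (f σ) x := by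
    rintro σ hσ x hx hxσ ⟨y, hyx, hy, hmem⟩
    obtain ⟨h1, h2, h3⟩ := hf σ hσ
    have hyE : y ∉ (f σ).erase x := fun h => hy (Finset.mem_of_mem_erase h)
    have hbasis : C.IsBasis (insert y ((f σ).erase x)) :=
      h2.of_card_eq (isIndependent_of_mem_brokenCircuitComplex hmem)
        (by rw [Finset.card_insert_of_notMem hyE, Finset.card_erase_add_one hx])
    refine (lexKey_lt_exchange hyx hy).not_ge (hfmax σ hσ _ hmem hbasis fun z hz => ?_)
    exact Finset.mem_insert_of_mem (Finset.mem_erase.2 ⟨fun h => hxσ (h ▸ hz), h3 hz⟩)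
  have hnoncrit : ∀ σ ∈ C.noncriticalComplex, ∃ x ∈ f σ, ¬ C.IsExchangeable (f σ) x := by
    intro σ hσ
    by_contra! hcrit
    obtain ⟨h1, h2, h3⟩ := hf σ hσ.1
    have hσf : ¬ f σ ⊆ σ := fun h =>
      hσ.2 (Finset.Subset.antisymm h3 h ▸ ⟨⟨h1, hcrit⟩, h2⟩)
    obtain ⟨x, hx, hxσ⟩ := Finset.not_subset.1 hσf
    exact hexch σ hσ.1 x hx hxσ (hcrit x hx)
  have hchoice : ∀ B : Finset S, ∃ x : S, (∃ x ∈ B, ¬ C.IsExchangeable B x) →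
      x ∈ B ∧ ¬ C.IsExchangeable B x := by
    intro B
    by_cases h : ∃ x ∈ B, ¬ C.IsExchangeable B x
    · obtain ⟨x, hx⟩ := h
      exact ⟨x, fun _ => hx⟩
    · obtain ⟨x, -⟩ := hnoncrit σ₀ hσ₀
      exact ⟨x, fun h' => absurd h' h⟩
  choose a ha using hchoice
  refine SimplicialPair.collapsesOnto_of_matching bot_le
    (fun σ => OrderDual.toDual (lexKey (f σ))) (fun σ => a (f σ)) ?_ ?_ ?_ ?_
  · intro σ ρ _ hρ hσρ
    obtain ⟨h1, h2, h3⟩ := hf ρ hρ.1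
    exact hfmax σ (C.brokenCircuitComplex.lower hσρ hρ.1) _ h1 h2 (hσρ.trans h3)
  · intro σ ρ _ _ _ _ h
    rw [lexKey_injective (OrderDual.toDual.injective h)]
  · intro σ hσ _
    obtain ⟨h1, h2, h3⟩ := hf σ hσ.1
    obtain ⟨hx, hxe⟩ := ha _ (hnoncrit σ hσ)
    have hsub : insert (a (f σ)) σ ⊆ f σ := Finset.insert_subset hx h3
    have hbc : insert (a (f σ)) σ ∈ C.brokenCircuitComplex :=
      C.brokenCircuitComplex.lower hsub h1
    refine ⟨⟨hbc, fun ⟨hcrit, hbasis⟩ => hxe ?_⟩, ?_⟩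
    · have heq := hbasis.eq_of_ge h2.prop hsub
      rw [← heq] at hcrit
      exact hcrit.2 _ hx
    · obtain ⟨h4, h5, h6⟩ := hf _ hbc
      exact congrArg OrderDual.toDual (le_antisymm
        (hfmax σ hσ.1 _ h4 h5 ((Finset.subset_insert _ _).trans h6))
        (hfmax _ hbc _ h1 h2 hsub))
  · intro σ hσ _
    refine ⟨id, ?_⟩
    obtain ⟨h1, h2, h3⟩ := hf σ hσ.1
    obtain ⟨hx, hxe⟩ := ha _ (hnoncrit σ hσ)
    have hbc : σ.erase (a (f σ)) ∈ C.brokenCircuitComplex :=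
      C.brokenCircuitComplex.lower (Finset.erase_subset _ _) hσ.1
    obtain ⟨h4, h5, h6⟩ := hf _ hbc
    refine congrArg OrderDual.toDual (le_antisymm ?_
      (hfmax _ hbc _ h1 h2 ((Finset.erase_subset _ _).trans h3)))
    by_contra! hlt
    obtain ⟨y, hy, hyf, hlex⟩ := lexKey_lt_iff.1 hlt
    obtain ⟨x, hxf, hxf', hxex⟩ := exists_isExchangeable h2 h1 h5.prop hy hyf hlex
    have hxσ : x ∉ σ := fun h =>
      hxf' (h6 (Finset.mem_erase.2 ⟨fun h' => hxe (h' ▸ hxex), h⟩))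
    exact hexch σ hσ.1 x hxf hxσ hxex

end BrokenCircuit

/-! ### Betti numbers and Poincaré polynomials -/

section Poincare
open SimplicialPair
variable {S : Type*} [LinearOrder S] [Fintype S]

theorem mem_nbcFinset {C : Semimatroid S} {σ : Finset S} :
    σ ∈ C.nbcFinset ↔ σ ∈ C.brokenCircuitComplex := by
  simp [nbcFinset]

theorem mem_criticalBases {C : Semimatroid S} {σ : Finset S} :
    σ ∈ C.criticalBases ↔ C.IsCritical σ ∧ C.IsBasis σ := by
  simp [criticalBases]

/-- The faces of rank at most `j`. -/
def rankSublevel (C : Semimatroid S) (j : ℕ) : LowerSet (Finset S) where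
  carrier := sublevel C.complex C.rank j
  lower' := fun _ _ hle h =>
    ⟨C.complex.lower hle h.1, (C.rank_mono _ (C.complex.lower hle h.1) _ h.1 hle).trans h.2⟩

/-- The faces of rank less than `j`, together with the no-broken circuits of rank `j`. -/
def rankSublevelNbc (C : Semimatroid S) (j : ℕ) : LowerSet (Finset S) where
  carrier := {σ | σ ∈ sublevel C.complex C.rank j ∧
    (C.rank σ < j ∨ σ ∈ C.brokenCircuitComplex)}
  lower' := fun _ _ hle h =>
    ⟨(C.rankSublevel j).lower hle h.1, h.2.imp
      (C.rank_mono _ ((C.rankSublevel j).lower hle h.1).1 _ h.1.1 hle).trans_lt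
      fun h' => C.brokenCircuitComplex.lower hle h'⟩

theorem rankSublevel_collapsesOnto (C : Semimatroid S) (j : ℕ) :
    CollapsesOnto (C.rankSublevel j) (C.rankSublevelNbc j) :=
  collapsesOnto_of_rank (fun _ h => h.1) (fun _ h => h.1) (fun _ h h' => ⟨h, Or.inr h'⟩)
    (fun _ h _ hτ hr => ⟨hτ, hr.le.trans h.2⟩)
    fun _ h _ hτ _ hσ hr => ⟨⟨hτ, hr.le.trans h.1.2⟩, Or.inl (hr ▸ h.2.resolve_right hσ)⟩

variable (R : Type*) [CommRing R]

theorem relBetti_rankSublevel [Nontrivial R] (C : Semimatroid S) (i j : ℕ) :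
    relBetti R (sublevel C.complex C.rank j) (strictSublevel C.complex C.rank j) i =
      if i = j then (C.nbcFinset.filter (fun σ => σ.card = j)).card else 0 := by
  obtain ⟨hsub, hacyc⟩ := (C.rankSublevel_collapsesOnto j).subset_and_relAcyclic (R := R)
  have hlow : IsLowerSet (strictSublevel C.complex C.rank j) := fun _ _ hle h =>
    ⟨C.complex.lower hle h.1, (C.rank_mono _ (C.complex.lower hle h.1) _ h.1 hle).trans_lt h.2⟩
  have hL : strictSublevel C.complex C.rank j ⊆ C.rankSublevelNbc j := fun _ h =>
    ⟨⟨h.1, h.2.le⟩, Or.inl h.2⟩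
  have hdiff : ∀ σ, (σ ∈ C.rankSublevelNbc j ∧ σ ∉ strictSublevel C.complex C.rank j) ↔
      σ ∈ C.brokenCircuitComplex ∧ σ.card = j := by
    intro σ
    constructor
    · rintro ⟨⟨h1, h2⟩, h3⟩
      have hlt : ¬ C.rank σ < j := fun h => h3 ⟨h1.1, h⟩
      have hσ := h2.resolve_left hlt
      refine ⟨hσ, ?_⟩
      rw [← rank_eq_card_of_mem_brokenCircuitComplex hσ]
      exact le_antisymm h1.2 (not_lt.1 hlt)
    · rintro ⟨hσ, hj⟩
      have hr := rank_eq_card_of_mem_brokenCircuitComplex hσ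
      exact ⟨⟨⟨hσ.1, by omega⟩, Or.inr hσ⟩, fun h => absurd h.2 (by omega)⟩
  have h1 := relBetti_eq_of_relAcyclic_left (C.rankSublevel j).lower hlow hsub hL hacyc i
  have h2 := relBetti_eq_ncard (R := R) (C.rankSublevelNbc j).lower hlow hL
    (fun σ h h' => ((hdiff σ).1 ⟨h, h'⟩).2) i
  refine h1.trans (h2.trans ?_)
  congr 1
  rw [← Set.ncard_coe_finset]
  congr 1
  ext σ
  simpa [mem_nbcFinset] using hdiff σ

theorem relBetti_complex [Nontrivial R] (C : Semimatroid S) (i : ℕ) :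
    relBetti R (C.complex : Set (Finset S)) ∅ i =
      (C.criticalBases.filter (fun σ => σ.card = i)).card := by
  obtain ⟨hsub, hacyc⟩ := C.collapsesOnto_brokenCircuitComplex.subset_and_relAcyclic (R := R)
  obtain ⟨-, hacyc'⟩ := C.noncriticalComplex_collapsesOnto_bot.subset_and_relAcyclic (R := R)
  have hsub' : (C.noncriticalComplex : Set (Finset S)) ⊆ C.brokenCircuitComplex := fun _ h => h.1
  have hdiff : ∀ σ, (σ ∈ C.brokenCircuitComplex ∧ σ ∉ C.noncriticalComplex) ↔
      C.IsCritical σ ∧ C.IsBasis σ := fun σ =>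
    ⟨fun h => not_not.1 fun h' => h.2 ⟨h.1, h'⟩, fun h => ⟨h.1.1, fun h' => h'.2 h⟩⟩
  rw [relBetti_eq_of_relAcyclic_left C.complex.lower (isLowerSet_empty) hsub (Set.empty_subset _)
      hacyc i]
  rw [relBetti_eq_of_relAcyclic_right C.brokenCircuitComplex.lower C.noncriticalComplex.lower
      (Set.empty_subset _) hsub' hacyc' i]
  have hcoe : ((C.brokenCircuitComplex : Set (Finset S)) \ C.noncriticalComplex) =
      C.criticalBases := by
    ext σ
    simpa [mem_criticalBases] using hdiff σ
  rcases C.criticalBases.eq_empty_or_nonempty with hemp | ⟨B, hB⟩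
  · have heq : C.noncriticalComplex = C.brokenCircuitComplex := by
      refine le_antisymm hsub' (Set.sdiff_eq_empty.1 ?_)
      rw [hcoe, hemp, Finset.coe_empty]
    rw [heq, relBetti_eq_zero_of_self, hemp]
    rfl
  rw [mem_criticalBases] at hB
  have hcard : ∀ σ ∈ C.criticalBases, σ.card = B.card := fun σ hσ => by
    rw [mem_criticalBases] at hσ
    exact le_antisymm (hB.2.card_le hσ.2.prop) (hσ.2.card_le hB.2.prop)
  rw [relBetti_eq_ncard C.brokenCircuitComplex.lower C.noncriticalComplex.lower hsub'
    (fun σ h h' => hcard σ (mem_criticalBases.2 ((hdiff σ).1 ⟨h, h'⟩))) i, hcoe,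
    Set.ncard_coe_finset]
  split_ifs with h
  · rw [Finset.filter_true_of_mem fun σ hσ => (hcard σ hσ).trans h.symm]
  · rw [Finset.filter_false_of_mem fun σ hσ h' => h (h'.symm.trans (hcard σ hσ)),
      Finset.card_empty]

theorem poincare_rank [Nontrivial R] (C : Semimatroid S) :
    poincare R C.complex C.rank =
      ∑ σ ∈ C.nbcFinset, (MvPolynomial.X 0 * MvPolynomial.X 1) ^ σ.card := by
  classical
  rw [← Finset.sum_fiberwise_of_maps_to (t := Finset.range (Fintype.card S + 1)) (g := Finset.card)
    fun σ _ => Finset.mem_range.2 (Nat.lt_succ_of_le σ.card_le_univ)]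
  refine Finset.sum_congr rfl fun i _ => ?_
  have hterm : ∀ j, (relBetti R (sublevel C.complex C.rank j)
      (strictSublevel C.complex C.rank j) i : MvPolynomial (Fin 2) ℤ) *
        (MvPolynomial.X 1 ^ j * MvPolynomial.X 0 ^ i) =
      if i = j then ∑ σ ∈ C.nbcFinset with σ.card = i,
        (MvPolynomial.X 0 * MvPolynomial.X 1) ^ σ.card else 0 := by
    intro j
    rw [relBetti_rankSublevel]
    split_ifs with h
    · subst h
      rw [Finset.sum_congr rfl fun σ hσ => by rw [(Finset.mem_filter.1 hσ).2], Finset.sum_const,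
        nsmul_eq_mul, mul_pow, mul_comm (MvPolynomial.X 1 ^ i)]
    · simp
  simp only [hterm, Finset.sum_ite_eq]
  split_ifs with h
  · rfl
  · symm
    refine Finset.sum_eq_zero fun σ hσ => absurd (Finset.mem_image.2 ⟨σ, ?_, ?_⟩) h
    · exact Finset.mem_filter.2 ⟨Finset.mem_univ _,
        (mem_nbcFinset.1 (Finset.mem_filter.1 hσ).1).1⟩
    · rw [rank_eq_card_of_mem_brokenCircuitComplex (mem_nbcFinset.1 (Finset.mem_filter.1 hσ).1)]
      exact (Finset.mem_filter.1 hσ).2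

theorem poincareComplex_eq [Nontrivial R] (C : Semimatroid S) :
    poincareComplex R C.complex = ∑ σ ∈ C.criticalBases, Polynomial.X ^ σ.card := by
  rw [← Finset.sum_fiberwise_of_maps_to (t := Finset.range (Fintype.card S + 1)) (g := Finset.card)
    fun σ _ => Finset.mem_range.2 (Nat.lt_succ_of_le σ.card_le_univ)]
  refine Finset.sum_congr rfl fun i _ => ?_
  rw [relBetti_complex, Finset.sum_congr rfl fun σ hσ => by rw [(Finset.mem_filter.1 hσ).2],
    Finset.sum_const, nsmul_eq_mul]

end Poincare

end Semimatroid

theorem theorem4p2 {S : Type*} [LinearOrder S] [Fintype S] (C : Semimatroid S)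
    (R : Type*) [CommRing R] [IsDomain R] :
    SimplicialPair.CollapsesOnto C.complex C.brokenCircuitComplex ∧
    SimplicialPair.poincare R C.complex C.rank =
      ∑ σ ∈ C.nbcFinset, (MvPolynomial.X 0 * MvPolynomial.X 1) ^ σ.card ∧
    SimplicialPair.poincareComplex R C.complex =
      ∑ σ ∈ C.criticalBases, Polynomial.X ^ σ.card :=
  ⟨C.collapsesOnto_brokenCircuitComplex, C.poincare_rank R, C.poincareComplex_eq R⟩
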